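/- For $n\ge 2$ let $Q_n^3$ be the 3-ary $n$-cube: its vertices are the $n$-tuples with entries in $\{0,1,2\}$, and two vertices are adjacent if and only if they differ by $\pm1 \pmod 3$ in one coordinate and agree in all the others. For $1\le k\le 3^n$ let $I(k)$ be the maximum, over all sets $A$ of $k$ vertices of $Q_n^3$, of the number of edges of $Q_n^3$ with both ends in $A$. Then $k$ has a base-3 expansion, that is, it can be written as $$k = 3^{k_1}+3^{k_2}+\dots+3^{k_r},\qquad k_1\ge k_2\ge\dots\ge k_r\ge 0,\quad\text{no three of the } k_i \text{ being equal},$$ and for every such expression $$I(k)=\sum_{i=1}^{r}\bigl(k_i+(i-1)\bigr)3^{k_i}.$$ Moreover, this maximum is attained by the set of the first $k$ vertices in lexicographic order (tuples being compared at the leftmost coordinate in which they differ). -/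

import Mathlib

/-- The 3-ary `n`-cube. A vertex is an `n`-tuple over `{0, 1, 2}`, its leftmost entry having index
`0`. The arithmetic of `Fin 3` is arithmetic modulo 3. -/
def ternaryCube (n : ℕ) : SimpleGraph (Fin n → Fin 3) where
  Adj x y := ∃ j, (x j = y j + 1 ∨ x j = y j - 1) ∧ ∀ i, i ≠ j → x i = y i
  symm := ⟨by
    rintro x y ⟨j, h, h'⟩
    refine ⟨j, ?_, fun i hi => (h' i hi).symm⟩
    generalize x j = a at h
    generalize y j = b at h
    revert a b
    decide⟩
  loopless := ⟨by
    rintro x ⟨j, h, -⟩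
    generalize x j = a at h
    revert a
    decide⟩

/-- The set of edges of `G` induced by the vertex set `A`: both ends lie in `A`. -/
def inducedEdges {V : Type*} (G : SimpleGraph V) (A : Finset V) : Set (Sym2 V) :=
  {e | e ∈ G.edgeSet ∧ ∀ v ∈ e, v ∈ A}

open Classical in
/-- The first `k` vertices of the 3-ary `n`-cube in lexicographic order: those that are preceded
by fewer than `k` vertices. (`toLex y < toLex x` says that `y` is smaller than `x` at the first
index where they differ.) -/
noncomputable def lexFirst (n k : ℕ) : Finset (Fin n → Fin 3) :=
  {x | (Finset.univ.filter fun y : Fin n → Fin 3 => toLex y < toLex x).card < k}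

/-- `k = 3 ^ κ 0 + ⋯ + 3 ^ κ (r - 1)` is the base-3 expansion of `k`, written as a sum of `r`
powers of 3 with weakly decreasing exponents: no power occurs three times. -/
structure IsTernaryExpansion (k r : ℕ) (κ : Fin r → ℕ) : Prop where
  sum_eq : k = ∑ i, 3 ^ κ i
  antitone : Antitone κ
  no_three : ∀ i j l : Fin r, i < j → j < l → ¬ (κ i = κ j ∧ κ j = κ l)

/-! Write S for `digitSumTotal`. Distinct residues mod 3 are always adjacent, so cutting the cube
along one coordinate gives three slices, and the edges joining two slices correspond to the points
of their intersection, at most the smaller size. By `digitSumTotal_add_add_min_le`, S absorbs these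
cross terms, so induction on n bounds the edge count by S of the cardinality.

An initial lexicographic segment, cut along its last coordinate, has nested initial segments of
nearly equal size as slices. Its intersections attain the minima, and its edge count obeys the
ternary recurrences of S, hence equals S(k).

Peeling off leading powers of 3 with `digitSumTotal_pow_add` evaluates S(k). -/

/-! ### Digit sums: recurrences and leading powers -/

/-- The sum of the base-3 digit sums of the numbers below `k`. -/
def digitSumTotal (k : ℕ) : ℕ := ∑ j ∈ Finset.range k, (Nat.digits 3 j).sum

theorem digits_three_sum (m d : ℕ) (hd : d < 3) :
    (Nat.digits 3 (3 * m + d)).sum = (Nat.digits 3 m).sum + d := by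
  rcases Nat.eq_zero_or_pos (3 * m + d) with h | h
  · obtain rfl : m = 0 := by omega
    obtain rfl : d = 0 := by omega
    simp
  · rw [Nat.digits_def' (by norm_num) h, List.sum_cons, show (3 * m + d) % 3 = d by omega,
      show (3 * m + d) / 3 = m by omega, add_comm]

theorem digitSumTotal_succ (k : ℕ) :
    digitSumTotal (k + 1) = digitSumTotal k + (Nat.digits 3 k).sum :=
  Finset.sum_range_succ _ _

@[simp] theorem digitSumTotal_zero : digitSumTotal 0 = 0 := rfl

theorem digitSumTotal_three_mul (m : ℕ) :
    digitSumTotal (3 * m) = 3 * digitSumTotal m + 3 * m := by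
  induction m with
  | zero => rfl
  | succ m ih =>
    have h0 := digits_three_sum m 0 (by norm_num)
    have h1 := digits_three_sum m 1 (by norm_num)
    have h2 := digits_three_sum m 2 (by norm_num)
    rw [show 3 * (m + 1) = 3 * m + 0 + 1 + 1 + 1 by ring]
    simp only [digitSumTotal_succ] at *
    simp only [add_zero, add_assoc, Nat.reduceAdd] at *
    omega

theorem digitSumTotal_three_mul_add_one (m : ℕ) :
    digitSumTotal (3 * m + 1) = 2 * digitSumTotal m + digitSumTotal (m + 1) + 3 * m := by
  have h0 := digits_three_sum m 0 (by norm_num)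
  rw [digitSumTotal_succ, digitSumTotal_succ, digitSumTotal_three_mul]
  simp only [add_zero] at h0
  omega

theorem digitSumTotal_three_mul_add_two (m : ℕ) :
    digitSumTotal (3 * m + 2) = digitSumTotal m + 2 * digitSumTotal (m + 1) + 3 * m + 1 := by
  have h0 := digits_three_sum m 1 (by norm_num)
  rw [digitSumTotal_succ, digitSumTotal_three_mul_add_one, digitSumTotal_succ]
  omega

theorem digitSumTotal_one : digitSumTotal 1 = 0 := by simp [digitSumTotal]

theorem digitSumTotal_two : digitSumTotal 2 = 1 := by
  simpa [digitSumTotal_one] using digitSumTotal_three_mul_add_two 0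

theorem digitSumTotal_three : digitSumTotal 3 = 3 := by
  simpa [digitSumTotal_one] using digitSumTotal_three_mul 1

theorem digitSumTotal_pow (q : ℕ) : digitSumTotal (3 ^ q) = q * 3 ^ q := by
  induction q with
  | zero => simpa using digitSumTotal_one
  | succ q ih => rw [pow_succ', digitSumTotal_three_mul, ih]; ring

/-- For j < m the digit of j at place q is at most 1, so adding 3^q causes no carry and raises the
digit sum by exactly 1. -/
theorem digitSumTotal_pow_add (q m : ℕ) (hm : m ≤ 2 * 3 ^ q) :
    digitSumTotal (3 ^ q + m) = q * 3 ^ q + m + digitSumTotal m := by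
  induction q generalizing m with
  | zero =>
    have : m ≤ 2 := by simpa using hm
    interval_cases m <;> simp [digitSumTotal_one, digitSumTotal_two, digitSumTotal_three]
  | succ q ih =>
    obtain ⟨a, d, hd, rfl⟩ : ∃ a d, d < 3 ∧ m = 3 * a + d :=
      ⟨m / 3, m % 3, Nat.mod_lt _ (by norm_num), by omega⟩
    rw [pow_succ] at hm
    have h0 := ih a (by omega)
    rw [show 3 ^ (q + 1) + (3 * a + d) = 3 * (3 ^ q + a) + d by ring,
      show (q + 1) * 3 ^ (q + 1) = 3 * (q * 3 ^ q) + 3 * 3 ^ q by ring]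
    interval_cases d
    · rw [add_zero, add_zero, digitSumTotal_three_mul, digitSumTotal_three_mul]
      omega
    · have h1 := ih (a + 1) (by omega)
      rw [← add_assoc] at h1
      rw [digitSumTotal_three_mul_add_one, digitSumTotal_three_mul_add_one]
      omega
    · have h1 := ih (a + 1) (by omega)
      rw [← add_assoc] at h1
      rw [digitSumTotal_three_mul_add_two, digitSumTotal_three_mul_add_two]
      omega

/-! ### Superadditivity of S -/

/-- Division by 3 turns each S-term into three values of S at the quotient or its successor.
Grouping these into three triples, each covered by the induction hypothesis, gives the bound. -/
theorem digitSumTotal_add_add_le (a b c : ℕ) (hba : b ≤ a) (hcb : c ≤ b) :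
    digitSumTotal a + digitSumTotal b + digitSumTotal c + b + 2 * c ≤
      digitSumTotal (a + b + c) := by
  induction a using Nat.strong_induction_on generalizing b c with
  | _ a ih =>
  -- The induction uses quotient + 1, which is smaller than `a` only once `a ≥ 2`.
  rcases Nat.lt_or_ge a 2 with ha | ha
  · interval_cases a <;> interval_cases b <;> interval_cases c <;>
      simp [digitSumTotal_one, digitSumTotal_two, digitSumTotal_three]
  obtain ⟨a, r, hr, rfl⟩ : ∃ m d, d < 3 ∧ a = 3 * m + d :=
    ⟨a / 3, a % 3, Nat.mod_lt _ (by norm_num), by omega⟩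
  obtain ⟨b, s, hs, rfl⟩ : ∃ m d, d < 3 ∧ b = 3 * m + d :=
    ⟨b / 3, b % 3, Nat.mod_lt _ (by norm_num), by omega⟩
  obtain ⟨c, t, ht, rfl⟩ : ∃ m d, d < 3 ∧ c = 3 * m + d :=
    ⟨c / 3, c % 3, Nat.mod_lt _ (by norm_num), by omega⟩
  replace ih : ∀ x y z w, z ≤ y → y ≤ x → x ≤ a + 1 → w = x + y + z →
      digitSumTotal x + digitSumTotal y + digitSumTotal z + y + 2 * z ≤ digitSumTotal w := by
    rintro x y z w hzy hyx hx rfl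
    exact ih x (by omega) y z hyx hzy
  obtain ⟨T, hT⟩ : ∃ T, T = a + b + c := ⟨_, rfl⟩
  rw [show 3 * a + r + (3 * b + s) + (3 * c + t) = 3 * T + (r + s + t) by omega]
  have e0 := digitSumTotal_three_mul
  have e1 := digitSumTotal_three_mul_add_one
  have e2 := digitSumTotal_three_mul_add_two
  -- The three remainders can add up to 6.
  have e3 : digitSumTotal (3 * T + 3) = _ := e0 (T + 1)
  have e4 : digitSumTotal (3 * T + 4) = _ := e1 (T + 1)
  have e5 : digitSumTotal (3 * T + 5) = _ := e2 (T + 1)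
  have e6 : digitSumTotal (3 * T + 6) = _ := e0 (T + 2)
  simp only [add_assoc, Nat.reduceAdd] at e4 e5
  -- The name records which quotients are raised by 1; ties between quotients decide which raised
  -- triples stay ordered.
  have i000 := ih a b c T (by omega) (by omega) (by omega) (by omega)
  have i100 := ih (a + 1) b c (T + 1) (by omega) (by omega) (by omega) (by omega)
  have i110 := ih (a + 1) (b + 1) c (T + 2) (by omega) (by omega) (by omega) (by omega)
  have i111 := ih (a + 1) (b + 1) (c + 1) (T + 3) (by omega) (by omega) (by omega) (by omega)
  obtain rfl | hab : a = b ∨ b + 1 ≤ a := by omega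
  · obtain rfl | hbc : c = a ∨ c + 1 ≤ a := by omega
    · interval_cases r <;> interval_cases s <;> interval_cases t <;>
        simp only [e0, e1, e2, e3, e4, e5, e6, add_zero, zero_add, Nat.reduceAdd] <;> omega
    · have i001 := ih a a (c + 1) (T + 1) (by omega) (by omega) (by omega) (by omega)
      have i101 := ih (a + 1) a (c + 1) (T + 2) (by omega) (by omega) (by omega) (by omega)
      interval_cases r <;> interval_cases s <;> interval_cases t <;>
        simp only [e0, e1, e2, e3, e4, e5, e6, add_zero, zero_add, Nat.reduceAdd] <;> omega
  · have i010 := ih a (b + 1) c (T + 1) (by omega) (by omega) (by omega) (by omega)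
    obtain rfl | hbc : c = b ∨ c + 1 ≤ b := by omega
    · have i011 := ih a (c + 1) (c + 1) (T + 2) (by omega) (by omega) (by omega) (by omega)
      interval_cases r <;> interval_cases s <;> interval_cases t <;>
        simp only [e0, e1, e2, e3, e4, e5, e6, add_zero, zero_add, Nat.reduceAdd] <;> omega
    · have i001 := ih a b (c + 1) (T + 1) (by omega) (by omega) (by omega) (by omega)
      have i101 := ih (a + 1) b (c + 1) (T + 2) (by omega) (by omega) (by omega) (by omega)
      have i011 := ih a (b + 1) (c + 1) (T + 2) (by omega) (by omega) (by omega) (by omega)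
      interval_cases r <;> interval_cases s <;> interval_cases t <;>
        simp only [e0, e1, e2, e3, e4, e5, e6, add_zero, zero_add, Nat.reduceAdd] <;> omega

theorem digitSumTotal_add_add_min_le (a b c : ℕ) :
    digitSumTotal a + digitSumTotal b + digitSumTotal c + (min a b + min a c + min b c) ≤
      digitSumTotal (a + b + c) := by
  have key := digitSumTotal_add_add_le
  rcases le_total a b with h1 | h1 <;> rcases le_total a c with h2 | h2 <;>
    rcases le_total b c with h3 | h3
  · have := key c b a h3 h1
    rw [show c + b + a = a + b + c by ring] at this; omega
  · have := key b c a h3 h2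
    rw [show b + c + a = a + b + c by ring] at this; omega
  · have := key b a c h1 h2
    rw [show b + a + c = a + b + c by ring] at this; omega
  · have := key b a c h1 h2
    rw [show b + a + c = a + b + c by ring] at this; omega
  · have := key c a b h2 h1
    rw [show c + a + b = a + b + c by ring] at this; omega
  · have := key c a b h2 h1
    rw [show c + a + b = a + b + c by ring] at this; omega
  · have := key a c b h2 h3
    rw [show a + c + b = a + b + c by ring] at this; omega
  · have := key a b c h1 h3
    omega

/-! ### Edges as downward steps -/

/-- `y` arises from `x` by lowering exactly one entry. -/
def StepDown {n : ℕ} (x y : Fin n → Fin 3) : Prop :=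
  ∃ j, y j < x j ∧ ∀ i, i ≠ j → x i = y i

theorem ternaryCube_adj_iff {n : ℕ} (x y : Fin n → Fin 3) :
    (ternaryCube n).Adj x y ↔ StepDown x y ∨ StepDown y x := by
  have key : ∀ a b : Fin 3, (a = b + 1 ∨ a = b - 1) ↔ (b < a ∨ a < b) := by decide
  constructor
  · rintro ⟨j, h, h'⟩
    rcases (key _ _).1 h with h | h
    · exact Or.inl ⟨j, h, h'⟩
    · exact Or.inr ⟨j, h, fun i hi => (h' i hi).symm⟩
  · rintro (⟨j, h, h'⟩ | ⟨j, h, h'⟩)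
    · exact ⟨j, (key _ _).2 (Or.inl h), h'⟩
    · exact ⟨j, (key _ _).2 (Or.inr h), fun i hi => (h' i hi).symm⟩

theorem StepDown.le {n : ℕ} {x y : Fin n → Fin 3} (h : StepDown x y) : y ≤ x := by
  obtain ⟨j, hj, h⟩ := h
  intro i
  rcases eq_or_ne i j with rfl | hi
  · exact hj.le
  · exact (h i hi).ge

theorem StepDown.ne {n : ℕ} {x y : Fin n → Fin 3} (h : StepDown x y) : x ≠ y := by
  rintro rfl
  obtain ⟨j, hj, -⟩ := h
  exact hj.false

theorem stepDown_snoc {n : ℕ} (t u : Fin n → Fin 3) (d e : Fin 3) :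
    StepDown (Fin.snoc t d : Fin (n + 1) → Fin 3) (Fin.snoc u e) ↔
      (StepDown t u ∧ d = e) ∨ (t = u ∧ e < d) := by
  unfold StepDown
  rw [Fin.exists_fin_succ']
  simp only [Fin.forall_fin_succ', Fin.snoc_castSucc, Fin.snoc_last, ne_eq, Fin.castSucc_inj,
    not_true_eq_false, false_imp_iff, and_true, Fin.castSucc_ne_last, (Fin.castSucc_ne_last _).symm,
    not_false_eq_true, true_imp_iff, funext_iff]
  constructor
  · rintro (⟨j, h1, h2, h3⟩ | ⟨h1, h2⟩)
    · exact Or.inl ⟨⟨j, h1, h2⟩, h3⟩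
    · exact Or.inr ⟨h2, h1⟩
  · rintro (⟨⟨j, h1, h2⟩, h3⟩ | ⟨h1, h2⟩)
    · exact Or.inl ⟨j, h1, h2, h3⟩
    · exact Or.inr ⟨h2, h1⟩

open Classical in
/-- The number of pairs in `A` whose second member arises from the first by lowering one entry. -/
noncomputable def stepCount {n : ℕ} (A : Finset (Fin n → Fin 3)) : ℕ :=
  ((A ×ˢ A).filter fun p => StepDown p.1 p.2).card

theorem ncard_inducedEdges {n : ℕ} (A : Finset (Fin n → Fin 3)) :
    (inducedEdges (ternaryCube n) A).ncard = stepCount A := by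
  classical
  have himage : inducedEdges (ternaryCube n) A =
      (fun p : (Fin n → Fin 3) × (Fin n → Fin 3) => s(p.1, p.2)) ''
        ((A ×ˢ A).filter fun p => StepDown p.1 p.2 : Finset _) := by
    ext e
    induction e with
    | _ x y =>
    simp only [inducedEdges, Set.mem_ofPred_eq, SimpleGraph.mem_edgeSet, ternaryCube_adj_iff,
      Sym2.mem_iff, forall_eq_or_imp, forall_eq, Set.mem_image, Finset.mem_coe, Finset.mem_filter,
      Finset.mem_product, Prod.exists, Sym2.eq_iff]
    constructor
    · rintro ⟨h | h, hx, hy⟩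
      · exact ⟨x, y, ⟨⟨hx, hy⟩, h⟩, Or.inl ⟨rfl, rfl⟩⟩
      · exact ⟨y, x, ⟨⟨hy, hx⟩, h⟩, Or.inr ⟨rfl, rfl⟩⟩
    · rintro ⟨a, b, ⟨⟨ha, hb⟩, h⟩, ⟨rfl, rfl⟩ | ⟨rfl, rfl⟩⟩
      · exact ⟨Or.inl h, ha, hb⟩
      · exact ⟨Or.inr h, hb, ha⟩
  rw [himage, Set.InjOn.ncard_image, Set.ncard_coe_finset]
  · rfl
  · rintro ⟨a, b⟩ hab ⟨c, d⟩ hcd h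
    simp only [Finset.mem_coe, Finset.mem_filter] at hab hcd
    rcases Sym2.eq_iff.1 h with ⟨rfl, rfl⟩ | ⟨rfl, rfl⟩
    · rfl
    · exact (hab.2.ne (le_antisymm hcd.2.le hab.2.le)).elim

/-! ### Slices along the last coordinate and the upper bound -/

/-- The set of tuples that become members of `A` when `d` is appended. -/
def lastSlice {n : ℕ} (A : Finset (Fin (n + 1) → Fin 3)) (d : Fin 3) : Finset (Fin n → Fin 3) :=
  Finset.univ.filter fun t => (Fin.snoc t d : Fin (n + 1) → Fin 3) ∈ A

theorem mem_lastSlice {n : ℕ} {A : Finset (Fin (n + 1) → Fin 3)} {d : Fin 3} {t : Fin n → Fin 3} :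
    t ∈ lastSlice A d ↔ (Fin.snoc t d : Fin (n + 1) → Fin 3) ∈ A := by
  simp [lastSlice]

theorem sum_snoc {n : ℕ} (f : (Fin (n + 1) → Fin 3) → ℕ) :
    ∑ x, f x = ∑ t : Fin n → Fin 3,
      (f (Fin.snoc t 0) + f (Fin.snoc t 1) + f (Fin.snoc t 2)) := by
  rw [← (Fin.snocEquiv fun _ : Fin (n + 1) => Fin 3).sum_comp, Fintype.sum_prod_type,
    Fin.sum_univ_three, ← Finset.sum_add_distrib, ← Finset.sum_add_distrib]
  rfl

theorem card_eq_card_lastSlice {n : ℕ} (A : Finset (Fin (n + 1) → Fin 3)) :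
    A.card = (lastSlice A 0).card + (lastSlice A 1).card + (lastSlice A 2).card := by
  have h : ∀ {m : ℕ} (B : Finset (Fin m → Fin 3)), B.card = ∑ x, if x ∈ B then 1 else 0 := by
    intro m B; simp
  rw [h A, sum_snoc, h (lastSlice A 0), h (lastSlice A 1), h (lastSlice A 2)]
  simp only [mem_lastSlice, Finset.sum_add_distrib]

open Classical in
theorem stepCount_eq_sum {n : ℕ} (A : Finset (Fin n → Fin 3)) :
    stepCount A = ∑ x, ∑ y, if x ∈ A ∧ y ∈ A ∧ StepDown x y then 1 else 0 := by
  rw [stepCount, ← Fintype.sum_prod_type' (fun x y => if x ∈ A ∧ y ∈ A ∧ StepDown x y then 1 else 0),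
    Finset.sum_boole, Nat.cast_id]
  congr 1
  ext p
  simp [and_assoc]

theorem stepCount_eq_lastSlice {n : ℕ} (A : Finset (Fin (n + 1) → Fin 3)) :
    stepCount A = stepCount (lastSlice A 0) + stepCount (lastSlice A 1) + stepCount (lastSlice A 2)
      + ((lastSlice A 0 ∩ lastSlice A 1).card + (lastSlice A 0 ∩ lastSlice A 2).card
        + (lastSlice A 1 ∩ lastSlice A 2).card) := by
  classical
  have hinter : ∀ B C : Finset (Fin n → Fin 3),
      (B ∩ C).card = ∑ t, ∑ u, if t ∈ C ∧ u ∈ B ∧ t = u then 1 else 0 := by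
    intro B C
    have : ∀ t u, (if t ∈ C ∧ u ∈ B ∧ t = u then 1 else 0)
        = if t = u then (if t ∈ B ∩ C then 1 else 0) else 0 := by
      intro t u
      rcases eq_or_ne t u with rfl | h
      · simp [and_comm]
      · simp [h]
    simp only [this, Finset.sum_ite_eq, Finset.mem_univ, if_true]
    simp only [Finset.sum_boole, Finset.filter_univ_mem, Nat.cast_id]
  have d01 : (0 : Fin 3) < 1 := by decide
  have d02 : (0 : Fin 3) < 2 := by decide
  have d12 : (1 : Fin 3) < 2 := by decide
  simp only [stepCount_eq_sum, hinter]
  rw [sum_snoc]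
  simp only [sum_snoc, stepDown_snoc, mem_lastSlice, d01, d02, d12, d01.ne, d02.ne, d12.ne,
    d01.ne', d02.ne', d12.ne', d01.not_gt, d02.not_gt, d12.not_gt, lt_self_iff_false, and_false,
    and_true, or_false, false_or, if_false, add_zero, Finset.sum_add_distrib]
  ring

theorem stepCount_le (n : ℕ) (A : Finset (Fin n → Fin 3)) :
    stepCount A ≤ digitSumTotal A.card := by
  classical
  induction n with
  | zero =>
    rw [stepCount, Finset.filter_false_of_mem]
    · simp
    · rintro p - ⟨j, -⟩
      exact j.elim0
  | succ n ih =>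
    have hinter : ∀ B C : Finset (Fin n → Fin 3), (B ∩ C).card ≤ min B.card C.card := fun B C =>
      le_min (Finset.card_le_card Finset.inter_subset_left)
        (Finset.card_le_card Finset.inter_subset_right)
    rw [stepCount_eq_lastSlice, card_eq_card_lastSlice]
    exact (add_le_add (add_le_add (add_le_add (ih _) (ih _)) (ih _))
      (add_le_add (add_le_add (hinter _ _) (hinter _ _)) (hinter _ _))).trans
      (digitSumTotal_add_add_min_le _ _ _)

/-! ### Initial lexicographic segments -/

open Classical in
/-- The number of vertices that precede `x` in lexicographic order. -/
noncomputable def lexRank {n : ℕ} (x : Fin n → Fin 3) : ℕ :=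
  (Finset.univ.filter fun y : Fin n → Fin 3 => toLex y < toLex x).card

theorem mem_lexFirst {n k : ℕ} {x : Fin n → Fin 3} : x ∈ lexFirst n k ↔ lexRank x < k := by
  simp only [lexFirst, lexRank, Finset.mem_filter, Finset.mem_univ, true_and]

theorem toLex_lt_iff {n : ℕ} (x y : Fin n → Fin 3) :
    toLex y < toLex x ↔ ∃ i, (∀ j, j < i → y j = x j) ∧ y i < x i :=
  Iff.rfl

theorem toLex_snoc_lt_iff {n : ℕ} (t u : Fin n → Fin 3) (d e : Fin 3) :
    toLex (Fin.snoc u e : Fin (n + 1) → Fin 3) < toLex (Fin.snoc t d : Fin (n + 1) → Fin 3) ↔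
      toLex u < toLex t ∨ (t = u ∧ e < d) := by
  simp only [toLex_lt_iff, Fin.exists_fin_succ', Fin.forall_fin_succ', Fin.snoc_castSucc,
    Fin.snoc_last, Fin.castSucc_lt_castSucc_iff, Fin.castSucc_lt_last, true_imp_iff,
    lt_self_iff_false, false_imp_iff, and_true, (Fin.castSucc_lt_last _).not_gt, funext_iff,
    eq_comm]

/-- The rank is the value of the tuple read in base 3, the last entry being the units digit. -/
theorem lexRank_snoc {n : ℕ} (t : Fin n → Fin 3) (d : Fin 3) :
    lexRank (Fin.snoc t d : Fin (n + 1) → Fin 3) = 3 * lexRank t + d := by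
  classical
  have h : ∀ {m : ℕ} (x : Fin m → Fin 3),
      lexRank x = ∑ y, if toLex y < toLex x then 1 else 0 := by
    intro m x; rw [lexRank, Finset.sum_boole, Nat.cast_id]
  have hsplit : ∀ (e : Fin 3) (u : Fin n → Fin 3),
      (if toLex u < toLex t ∨ (t = u ∧ e < d) then 1 else 0) =
        (if toLex u < toLex t then 1 else 0) + if t = u then (if e < d then 1 else 0) else 0 := by
    intro e u
    rcases eq_or_ne t u with rfl | hu
    · have hirr : ¬ toLex t < toLex t := fun ⟨_, _, hi⟩ => hi.false
      simp [hirr]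
    · simp [hu]
  have hd : (if (0 : Fin 3) < d then 1 else 0) + (if (1 : Fin 3) < d then 1 else 0)
      + (if (2 : Fin 3) < d then 1 else 0) = (d : ℕ) := by
    clear hsplit; revert d; decide
  rw [h, h, sum_snoc, ← hd]
  simp only [toLex_snoc_lt_iff, hsplit, Finset.sum_add_distrib, Finset.sum_ite_eq, Finset.mem_univ,
    if_true]
  ring

/-- 3ρ + d < k means ρ < ⌈(k - d)/3⌉; the subtraction never truncates because d ≤ 2. -/
theorem lastSlice_lexFirst (n k : ℕ) (d : Fin 3) :
    lastSlice (lexFirst (n + 1) k) d = lexFirst n ((k + 2 - d) / 3) := by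
  ext t
  rw [mem_lastSlice, mem_lexFirst, mem_lexFirst, lexRank_snoc]
  omega

theorem lexFirst_subset {n k l : ℕ} (h : k ≤ l) : lexFirst n k ⊆ lexFirst n l := by
  intro x hx
  rw [mem_lexFirst] at *
  omega

theorem card_lexFirst (n k : ℕ) (hk : k ≤ 3 ^ n) : (lexFirst n k).card = k := by
  classical
  induction n generalizing k with
  | zero =>
    have hrank : ∀ x : Fin 0 → Fin 3, lexRank x = 0 := by
      intro x
      rw [lexRank, Finset.card_eq_zero, Finset.filter_eq_empty_iff]
      intro y _
      rw [Subsingleton.elim y x]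
      exact lt_irrefl _
    have h : ∀ x, x ∈ lexFirst 0 k ↔ 0 < k := fun x => by rw [mem_lexFirst, hrank]
    rw [pow_zero] at hk
    interval_cases k
    · rw [Finset.card_eq_zero, Finset.eq_empty_iff_forall_notMem]
      simpa using h
    · rw [show lexFirst 0 1 = Finset.univ from Finset.eq_univ_iff_forall.2 (by simpa using h)]
      simp
  | succ n ih =>
    rw [pow_succ] at hk
    simp only [card_eq_card_lastSlice, lastSlice_lexFirst, Fin.val_zero, Fin.val_one, Fin.val_two]
    rw [ih _ (by omega), ih _ (by omega), ih _ (by omega)]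
    omega

theorem stepCount_lexFirst (n k : ℕ) (hk : k ≤ 3 ^ n) :
    stepCount (lexFirst n k) = digitSumTotal k := by
  classical
  induction n generalizing k with
  | zero =>
    rw [stepCount, Finset.filter_false_of_mem]
    · rw [pow_zero] at hk
      interval_cases k <;> simp [digitSumTotal_one]
    · rintro p - ⟨j, -⟩
      exact j.elim0
  | succ n ih =>
    rw [pow_succ] at hk
    simp only [stepCount_eq_lastSlice, lastSlice_lexFirst, Fin.val_zero, Fin.val_one, Fin.val_two]
    rw [Finset.inter_eq_right.2 (lexFirst_subset (by omega)),
      Finset.inter_eq_right.2 (lexFirst_subset (by omega)),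
      Finset.inter_eq_right.2 (lexFirst_subset (by omega)),
      card_lexFirst _ _ (by omega), card_lexFirst _ _ (by omega),
      ih _ (by omega), ih _ (by omega), ih _ (by omega)]
    obtain ⟨a, d, hd, rfl⟩ : ∃ a d, d < 3 ∧ k = 3 * a + d :=
      ⟨k / 3, k % 3, Nat.mod_lt _ (by norm_num), by omega⟩
    interval_cases d
    · rw [show (3 * a + 0 + 2 - 0) / 3 = a by omega, show (3 * a + 0 + 2 - 1) / 3 = a by omega,
        show (3 * a + 0 + 2 - 2) / 3 = a by omega, add_zero, digitSumTotal_three_mul]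
      ring
    · rw [show (3 * a + 1 + 2 - 0) / 3 = a + 1 by omega, show (3 * a + 1 + 2 - 1) / 3 = a by omega,
        show (3 * a + 1 + 2 - 2) / 3 = a by omega, digitSumTotal_three_mul_add_one]
      ring
    · rw [show (3 * a + 2 + 2 - 0) / 3 = a + 1 by omega,
        show (3 * a + 2 + 2 - 1) / 3 = a + 1 by omega,
        show (3 * a + 2 + 2 - 2) / 3 = a by omega, digitSumTotal_three_mul_add_two]
      ring

/-! ### Ternary expansions -/

theorem IsTernaryExpansion.tail {k r : ℕ} {κ : Fin (r + 1) → ℕ} (h : IsTernaryExpansion k (r + 1) κ) :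
    IsTernaryExpansion (∑ i : Fin r, 3 ^ κ i.succ) r fun i => κ i.succ where
  sum_eq := rfl
  antitone _ _ hij := h.antitone (Fin.succ_le_succ_iff.2 hij)
  no_three i j l hij hjl :=
    h.no_three i.succ j.succ l.succ (Fin.succ_lt_succ_iff.2 hij) (Fin.succ_lt_succ_iff.2 hjl)

theorem IsTernaryExpansion.card_fiber_le {k r : ℕ} {κ : Fin r → ℕ} (h : IsTernaryExpansion k r κ)
    (e : ℕ) : (Finset.univ.filter fun i => κ i = e).card ≤ 2 := by
  by_contra! hc
  let f : Fin 3 ↪o Fin r := Finset.orderEmbOfCardLe _ (Nat.succ_le_of_lt hc)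
  have hmem : ∀ i, κ (f i) = e := fun i =>
    (Finset.mem_filter.1 (Finset.orderEmbOfCardLe_mem _ (Nat.succ_le_of_lt hc) i)).2
  exact h.no_three (f 0) (f 1) (f 2) (f.strictMono (by decide)) (f.strictMono (by decide))
    ⟨(hmem 0).trans (hmem 1).symm, (hmem 1).trans (hmem 2).symm⟩

theorem IsTernaryExpansion.lt_pow {k r : ℕ} {κ : Fin r → ℕ} (h : IsTernaryExpansion k r κ) (q : ℕ)
    (hq : ∀ i, κ i < q) : k < 3 ^ q := by
  have hfib : k ≤ ∑ e ∈ Finset.range q, 2 * 3 ^ e := by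
    rw [h.sum_eq, ← Finset.sum_fiberwise_of_maps_to (t := Finset.range q) (g := κ)
      (fun i _ => Finset.mem_range.2 (hq i))]
    refine Finset.sum_le_sum fun e _ => ?_
    rw [Finset.sum_congr rfl (g := fun _ => 3 ^ e)
      (fun i hi => by rw [(Finset.mem_filter.1 hi).2]), Finset.sum_const, smul_eq_mul]
    exact Nat.mul_le_mul_right _ (h.card_fiber_le e)
  have hgeom : ∀ q : ℕ, ∑ e ∈ Finset.range q, 2 * 3 ^ e + 1 = 3 ^ q := by
    intro q
    induction q with
    | zero => rfl
    | succ q ih => rw [Finset.sum_range_succ, pow_succ]; omega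
  have := hgeom q
  omega

/-- Peeling off the leading power adds the remainder m once, which raises the index weight of every
later term by 1. -/
theorem IsTernaryExpansion.digitSumTotal_eq {k r : ℕ} {κ : Fin r → ℕ}
    (h : IsTernaryExpansion k r κ) :
    digitSumTotal k = ∑ i : Fin r, (κ i + (i : ℕ)) * 3 ^ κ i := by
  induction r generalizing k with
  | zero => simp [h.sum_eq]
  | succ r ih =>
    have hk := h.sum_eq
    rw [Fin.sum_univ_succ] at hk
    have hlt := h.lt_pow (κ 0 + 1) fun i => Nat.lt_succ_of_le (h.antitone (Fin.zero_le i))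
    rw [pow_succ] at hlt
    rw [hk, digitSumTotal_pow_add _ _ (by omega), ih h.tail, Fin.sum_univ_succ, add_assoc,
      ← Finset.sum_add_distrib]
    simp only [Fin.val_zero, add_zero, Fin.val_succ]
    congr 1
    exact Finset.sum_congr rfl fun i _ => by ring

/-- Greedy choice of the largest power. -/
theorem exists_isTernaryExpansion (k : ℕ) :
    ∃ (r : ℕ) (κ : Fin r → ℕ), IsTernaryExpansion k r κ := by
  induction k using Nat.strong_induction_on with
  | _ k ih =>
  rcases Nat.eq_zero_or_pos k with rfl | hk
  · exact ⟨0, Fin.elim0, by simp, fun i => i.elim0, fun i => i.elim0⟩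
  set q := Nat.log 3 k
  have hle : 3 ^ q ≤ k := Nat.pow_log_le_self 3 hk.ne'
  have hlt : k < 3 ^ (q + 1) := Nat.lt_pow_succ_log_self (by norm_num) k
  have hpos : 0 < 3 ^ q := by positivity
  obtain ⟨r, κ, h⟩ := ih (k - 3 ^ q) (by omega)
  have hterm : ∀ i, 3 ^ κ i ≤ k - 3 ^ q := fun i => by
    rw [h.sum_eq]
    exact Finset.single_le_sum (f := fun i => 3 ^ κ i) (fun _ _ => Nat.zero_le _)
      (Finset.mem_univ i)
  have hκ : ∀ i, κ i ≤ q := fun i =>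
    Nat.lt_succ_iff.1 ((Nat.pow_lt_pow_iff_right (by norm_num : 1 < 3)).1
      ((hterm i).trans_lt (by omega)))
  refine ⟨r + 1, Fin.cons q κ, ?_, ?_, ?_⟩
  · rw [Fin.sum_univ_succ]
    simp only [Fin.cons_zero, Fin.cons_succ, ← h.sum_eq]
    omega
  · intro i j hij
    induction i using Fin.cases with
    | zero => induction j using Fin.cases with
      | zero => exact le_rfl
      | succ j => simpa using hκ j
    | succ i => induction j using Fin.cases with
      | zero => exact absurd hij (by simp)
      | succ j => simpa using h.antitone (Fin.succ_le_succ_iff.1 hij)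
  · intro i j l hij hjl
    obtain ⟨j, rfl⟩ := Fin.exists_succ_eq.2 (Fin.ne_zero_of_lt hij)
    obtain ⟨l, rfl⟩ := Fin.exists_succ_eq.2 (Fin.ne_zero_of_lt hjl)
    rw [Fin.succ_lt_succ_iff] at hjl
    induction i using Fin.cases with
    | succ i => simpa using h.no_three i j l (Fin.succ_lt_succ_iff.1 hij) hjl
    | zero =>
      rintro ⟨h1, h2⟩
      simp only [Fin.cons_zero, Fin.cons_succ] at h1 h2
      -- Three copies of 3^q would give k ≥ 3^(q+1).
      have hpair : 3 ^ κ j + 3 ^ κ l ≤ k - 3 ^ q := by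
        rw [h.sum_eq, ← Finset.sum_pair (f := fun i => 3 ^ κ i) hjl.ne]
        exact Finset.sum_le_sum_of_subset (Finset.subset_univ _)
      rw [← h2, ← h1] at hpair
      rw [pow_succ] at hlt
      omega
theorem theorem3p5 (n : ℕ) (hn : 2 ≤ n) (k : ℕ) (hk : 1 ≤ k) (hkn : k ≤ 3 ^ n) :
    (∃ (r : ℕ) (κ : Fin r → ℕ), IsTernaryExpansion k r κ) ∧
    ∀ (r : ℕ) (κ : Fin r → ℕ), IsTernaryExpansion k r κ →
      IsGreatest {m : ℕ | ∃ A : Finset (Fin n → Fin 3),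
          A.card = k ∧ (inducedEdges (ternaryCube n) A).ncard = m}
        (∑ i : Fin r, (κ i + (i : ℕ)) * 3 ^ κ i) ∧
      (lexFirst n k).card = k ∧
      (inducedEdges (ternaryCube n) (lexFirst n k)).ncard =
        ∑ i : Fin r, (κ i + (i : ℕ)) * 3 ^ κ i := by
  refine ⟨exists_isTernaryExpansion k, fun r κ h => ?_⟩
  have hcard := card_lexFirst n k hkn
  have hedges : (inducedEdges (ternaryCube n) (lexFirst n k)).ncard =
      ∑ i : Fin r, (κ i + (i : ℕ)) * 3 ^ κ i := by
    rw [ncard_inducedEdges, stepCount_lexFirst n k hkn, h.digitSumTotal_eq]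
  refine ⟨⟨⟨_, hcard, hedges⟩, ?_⟩, hcard, hedges⟩
  rintro m ⟨A, hA, rfl⟩
  rw [ncard_inducedEdges, ← h.digitSumTotal_eq, ← hA]
  exact stepCount_le n A
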